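/- Fix $n\ge 2$ and let $|\mathrm{GHZ}_n\rangle=\frac1{\sqrt2}(|0\rangle^{\otimes n}+|1\rangle^{\otimes n})$. A circuit is a sequence of layers, each a tensor product of arbitrary two-qubit unitaries acting on disjoint pairs of qubits (identity on the remaining qubits); its depth is the number of layers. For a connectivity graph on the qubits, gates may act only on pairs of adjacent qubits, and the circuit complexity of a state $|\psi\rangle$ is the least depth of a circuit $C$ with $C|0\rangle^{\otimes n}=|\psi\rangle$. On the square lattice, the complexity is the least such depth over all placements of the $n$ qubits at distinct sites of $\mathbb Z^2$, gates acting on nearest neighbours. Let $\gamma_2(D)$ be the largest cardinality of a set of points of $\mathbb Z^2$ obtained from $\{(0,0)\}$ in $D$ steps, where in each step every point of the current set may add at most one of its nearest neighbours. (1) $|\mathrm{GHZ}_n\rangle$ is not uniquely determined among all (mixed) states by its reduced density matrices on at most $n-1$ qubits: there is a density matrix $\rho\ne|\mathrm{GHZ}_n\rangle\langle\mathrm{GHZ}_n|$ with the same reduced density matrices on all subsets of at most $n-1$ qubits. (2) The circuit complexity of $|\mathrm{GHZ}_n\rangle$ is exactly - $\lceil\log_2 n\rceil$ if gates may act on any pair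 of qubits; - $\lceil n/2\rceil$ on the one-dimensional chain of $n$ qubits; - $\min\{D\in\mathbb N:\gamma_2(D)\ge n\}$ on the square lattice. Equivalently, this number is $\max\{\lceil x\rceil : x\ge 0,\ \gamma_2(x)\le n\}$ for every extension of $\gamma_2$ to a continuous strictly increasing function on $[0,\infty)$; and, if $E$ is the greatest integer with $\gamma_2(E)\le n$, it is $E$ when $\gamma_2(E)=n$ and $E+1$ otherwise. (3) In each of the three cases the value is attained (on the square lattice, for a suitable placement) by a circuit whose first layer is a single gate preparing a Bell pair from $|00\rangle$ and all of whose later gates are CNOTs with control on a qubit already entangled by earlier layers and target on a fresh qubit. -/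

import Mathlib

noncomputable section

namespace QCircuit

open scoped ComplexOrder

/-! ### Registers of qubits

A register of qubits is a finite type `Q`; its computational basis states are the maps
`Q → Fin 2`, state vectors are amplitude functions, operators are matrices in that basis. -/

/-- Labels of the computational basis of the register `Q`. -/
abbrev Bits (Q : Type*) := Q → Fin 2

/-- (Not necessarily normalized) vectors of the register `Q`. -/
abbrev Ket (Q : Type*) := Bits Q → ℂ

/-- Operators on the register `Q`. -/
abbrev Op (Q : Type*) := Matrix (Bits Q) (Bits Q) ℂ

section Register

variable {Q : Type*} [Fintype Q] [DecidableEq Q]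

/-- The initial state `|0…0⟩`. -/
def ketZero : Ket Q := Pi.single (fun _ => 0) 1

/-- The state `|1…1⟩`. -/
def ketOne : Ket Q := Pi.single (fun _ => 1) 1

/-- The GHZ state `(|0…0⟩ + |1…1⟩) / √2`. -/
def ghz : Ket Q := ((Real.sqrt 2 : ℂ))⁻¹ • (ketZero + ketOne)

/-! ### Reduced density matrices and unique determination among all states -/

/-- Density matrices, i.e. general (mixed) states. -/
structure IsDensityMatrix (ρ : Op Q) : Prop where
  posSemidef : ρ.PosSemidef
  trace_eq_one : ρ.trace = 1

/-- The operator `|ψ⟩⟨ψ|`. -/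
def pureState (ψ : Ket Q) : Op Q := Matrix.vecMulVec ψ (star ψ)

/-- Combine a basis label of the subsystem `s` with one of its complement. -/
def glue (s : Finset Q) (a : Bits s) (c : Bits {q : Q // q ∉ s}) : Bits Q :=
  fun q => if h : q ∈ s then a ⟨q, h⟩ else c ⟨q, h⟩

/-- The reduced density matrix on `s`: the partial trace of `ρ` over the complement of `s`. -/
def reduced (s : Finset Q) (ρ : Op Q) : Matrix (Bits s) (Bits s) ℂ :=
  fun a b => ∑ c : Bits {q : Q // q ∉ s}, ρ (glue s a c) (glue s b c)

/-- `ψ` is uniquely determined among all (mixed) states by its reduced density matrices on the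
subsystems in the family `𝒮`. -/
def IsUDA (𝒮 : Set (Finset Q)) (ψ : Ket Q) : Prop :=
  ∀ ρ : Op Q, IsDensityMatrix ρ →
    (∀ s ∈ 𝒮, reduced s ρ = reduced s (pureState ψ)) → ρ = pureState ψ

/-- The family of all subsystems of at most `k` qubits. -/
def localSubsystems (Q : Type*) (k : ℕ) : Set (Finset Q) := {s | s.card ≤ k}

/-! ### Circuits of two-qubit gates on a connectivity graph -/

/-- A two-qubit gate: an arbitrary unitary of two qubits that are adjacent in `G`. -/
structure Gate (G : SimpleGraph Q) where
  fst : Q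
  snd : Q
  adj : G.Adj fst snd
  mat : Matrix.unitaryGroup (Fin 2 × Fin 2) ℂ

variable {G : SimpleGraph Q}

/-- The gate as an operator on the whole register: identity on all other qubits. -/
def Gate.toOp (g : Gate G) : Op Q :=
  fun x y =>
    if ∀ q, q ≠ g.fst → q ≠ g.snd → x q = y q then
      (g.mat : Matrix (Fin 2 × Fin 2) (Fin 2 × Fin 2) ℂ) (x g.fst, x g.snd) (y g.fst, y g.snd)
    else 0

/-- The qubits on which a gate acts. -/
def Gate.support (g : Gate G) : Finset Q := {g.fst, g.snd}

/-- A layer: gates that act on pairwise disjoint pairs of qubits; a qubit may be idle. -/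
structure Layer (G : SimpleGraph Q) where
  gates : List (Gate G)
  pairwise_disjoint : gates.Pairwise (fun g h => Disjoint g.support h.support)

/-- The operator of a layer. The factors act on disjoint qubits, so that they commute and the
product is the tensor product of the gates. -/
def Layer.toOp (L : Layer G) : Op Q := (L.gates.map Gate.toOp).prod

/-- A circuit is the list of its layers, the first layer being applied first; its depth is the
length of the list. -/
abbrev Circuit (G : SimpleGraph Q) := List (Layer G)

/-- The output `U_D ⋯ U_1 |0…0⟩` of the circuit `[U_1, …, U_D]`. -/
def output (C : Circuit G) : Ket Q := C.foldl (fun ψ L => L.toOp.mulVec ψ) ketZero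

/-- The circuit complexity of `ψ` when gates act along edges of `G`: the least depth of a circuit
with output `ψ` (and `⊤` if there is none). -/
def circuitComplexity (G : SimpleGraph Q) (ψ : Ket Q) : ℕ∞ :=
  ⨅ C : {C : Circuit G // output C = ψ}, (C.1.length : ℕ∞)

/-! ### Circuits that grow a GHZ state by CNOT gates -/

/-- The CNOT matrix; the first qubit is the control. -/
def cnot : Matrix (Fin 2 × Fin 2) (Fin 2 × Fin 2) ℂ :=
  fun x y => if x = (y.1, y.1 + y.2) then 1 else 0

/-- The gate sends `|00⟩` to the Bell state `(|00⟩ + |11⟩) / √2`. -/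
def Gate.MakesBell (g : Gate G) : Prop :=
  ∀ a b : Fin 2, (g.mat : Matrix (Fin 2 × Fin 2) (Fin 2 × Fin 2) ℂ) (a, b) (0, 0) =
    if a = b then ((Real.sqrt 2 : ℂ))⁻¹ else 0

/-- `IsCnotGrowth C S`: the first layer of `C` is a single gate preparing a Bell pair; every
gate of a later layer is a CNOT from a qubit that was already reached onto a qubit that was not;
and `S` is the set of qubits that are reached in the end. -/
inductive IsCnotGrowth : Circuit G → Finset Q → Prop
  | bell (L : Layer G) (g : Gate G) (hL : L.gates = [g]) (hg : g.MakesBell) :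
      IsCnotGrowth [L] g.support
  | step (C : Circuit G) (S : Finset Q) (L : Layer G) (hC : IsCnotGrowth C S)
      (hL : ∀ g ∈ L.gates,
        (g.mat : Matrix (Fin 2 × Fin 2) (Fin 2 × Fin 2) ℂ) = cnot ∧ g.fst ∈ S ∧ g.snd ∉ S) :
      IsCnotGrowth (C ++ [L]) (S ∪ (L.gates.map Gate.snd).toFinset)

/-- Some circuit of depth `D` prepares the GHZ state of the whole register by CNOT growth. -/
def GhzByCnotGrowth (G : SimpleGraph Q) (D : ℕ) : Prop :=
  ∃ C : Circuit G, C.length = D ∧ IsCnotGrowth C Finset.univ ∧ output C = ghz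

end Register

/-! ### The square lattice -/

/-- The square lattice `ℤ²` with edges between nearest neighbours. -/
def squareLattice : SimpleGraph (ℤ × ℤ) where
  Adj p q := |p.1 - q.1| + |p.2 - q.2| = 1
  symm := ⟨fun p q h => by rw [abs_sub_comm q.1, abs_sub_comm q.2]; exact h⟩
  loopless := ⟨fun p h => by simp at h⟩

/-- The connectivity graph of `n` qubits that sit at distinct sites of the square lattice. -/
abbrev layoutGraph {n : ℕ} (site : Fin n ↪ ℤ × ℤ) : SimpleGraph (Fin n) :=
  squareLattice.comap site

/-- The circuit complexity of an `n`-qubit state on the square lattice: the least depth over all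
placements of the qubits at `n` distinct sites. -/
def squareLatticeComplexity {n : ℕ} (ψ : Ket (Fin n)) : ℕ∞ :=
  ⨅ site : Fin n ↪ ℤ × ℤ, circuitComplexity (layoutGraph site) ψ

/-- `Grown D S`: starting from `{(0,0)}`, the set `S` is obtained in `D` steps, where in each step
every point of the current set adds at most one of its neighbours (`f p = p`: adds nothing). -/
inductive Grown : ℕ → Finset (ℤ × ℤ) → Prop
  | zero : Grown 0 {(0, 0)}
  | succ (D : ℕ) (S : Finset (ℤ × ℤ)) (f : ℤ × ℤ → ℤ × ℤ) (hS : Grown D S)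
      (hf : ∀ p ∈ S, f p = p ∨ squareLattice.Adj p (f p)) :
      Grown (D + 1) (S ∪ S.image f)

/-- The largest size of a set of lattice points that can be grown in `D` steps. -/
def gamma2 (D : ℕ) : ℕ := sSup {m | ∃ S, Grown D S ∧ S.card = m}

theorem Grown.card_le {D : ℕ} {S : Finset (ℤ × ℤ)} (h : Grown D S) : S.card ≤ 2 ^ D := by
  induction h with
  | zero => simp
  | succ D S f hS hf ih =>
    have h1 := Finset.card_union_le S (S.image f)
    have h2 : (S.image f).card ≤ S.card := Finset.card_image_le
    rw [pow_succ]
    omega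

theorem exists_grown (D : ℕ) : ∃ S, Grown D S := by
  induction D with
  | zero => exact ⟨_, .zero⟩
  | succ D ih =>
    obtain ⟨S, hS⟩ := ih
    exact ⟨_, .succ D S id hS (fun p _ => Or.inl rfl)⟩

/-- The supremum in the definition of `gamma2` is a maximum. -/
theorem gamma2_isGreatest (D : ℕ) : IsGreatest {m | ∃ S, Grown D S ∧ S.card = m} (gamma2 D) := by
  have hb : BddAbove {m | ∃ S, Grown D S ∧ S.card = m} :=
    ⟨2 ^ D, by rintro m ⟨S, hS, rfl⟩; exact hS.card_le⟩
  obtain ⟨S, hS⟩ := exists_grown D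
  exact ⟨Nat.sSup_mem ⟨_, S, hS, rfl⟩ hb, fun m hm => le_csSup hb hm⟩

end QCircuit

end

/-!
The complexity of the GHZ state on a connectivity graph `G` is the least number of steps in which
the whole register grows from a single qubit (`GrowsFrom`), where in each step every reached qubit
adds at most one neighbour.

*Lower bound.* Let `U` be the unitary of a circuit of depth `D` with `U |0…0⟩ = |GHZ⟩`, and let
`P_q = |1⟩⟨1|` on the qubit `q`. Layer by layer, conjugation enlarges the support of `P_q` at most
by the partners of its qubits, so `A_q = U P_q U⁻¹` acts on a set grown from `q` in `D` steps
(`exists_lightCone`; "acting on `S`" is membership in the algebra generated by the matrix units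
on the qubits of `S`). If no such set were the whole register, there would be, for every `q`, a
qubit `r` outside the support of `A_q`; then `A_q` commutes with the Pauli operator `Z_r`, and
`A_q |GHZ⟩ = U P_q |0…0⟩ = 0` gives `A_q Z_r |GHZ⟩ = 0`. But `Z_r |GHZ⟩` is the same state
`|GHZ⁻⟩ = (|0…0⟩ - |1…1⟩)/√2` for every `r`. Hence `P_q U⁻¹ |GHZ⁻⟩ = 0` for all `q`, so that
`U⁻¹ |GHZ⁻⟩` is a multiple of `|0…0⟩` and `|GHZ⁻⟩` one of `|GHZ⟩`, which is absurd
(`exists_growsFrom_univ`). Comparing all backward light cones pairwise would give a weaker bound.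

*Upper bound.* A growth of the register is carried out by a Bell pair followed by layers of CNOTs
from reached onto new qubits (`GrowsFrom.exists_isCnotGrowth`), and such a circuit prepares the GHZ
state of the qubits reached (`IsCnotGrowth.output_eq`).

What is left is the combinatorics of growth: doubling on the complete graph, at most one site at
either end of an interval on the chain, and `gamma2` on the square lattice, where a growth to at
least `n` points can be trimmed to exactly `n` points (`GrowsFrom.exists_card_eq`) and `gamma2` is
strictly increasing. The state `|GHZ⁻⟩` also has the marginals of `|GHZ⟩` on every proper subset
of the register (`pureState_ghzMinus_apply`), so that these do not determine the GHZ state.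
-/

noncomputable section

namespace QCircuit

/-! ### Growth of vertex sets in a graph -/

section Growth

variable {V : Type*} [DecidableEq V]

/-- `GrowsFrom G q D S`: the set `S` is obtained from `{q}` in `D` steps, in each of which every
vertex of the current set adds at most one of its neighbours in `G` (`f p = p`: adds nothing). -/
inductive GrowsFrom (G : SimpleGraph V) (q : V) : ℕ → Finset V → Prop
  | zero : GrowsFrom G q 0 {q}
  | succ (D : ℕ) (S : Finset V) (f : V → V) (hS : GrowsFrom G q D S)
      (hf : ∀ p ∈ S, f p = p ∨ G.Adj p (f p)) : GrowsFrom G q (D + 1) (S ∪ S.image f)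

variable {G : SimpleGraph V} {q : V} {D : ℕ} {S T : Finset V}

theorem GrowsFrom.mem (h : GrowsFrom G q D S) : q ∈ S := by
  induction h with
  | zero => simp
  | succ D S f _ _ ih => simp [ih]

theorem GrowsFrom.card_le (h : GrowsFrom G q D S) : S.card ≤ 2 ^ D := by
  induction h with
  | zero => simp
  | succ D S f _ _ ih =>
    have h1 := Finset.card_union_le S (S.image f)
    have h2 : (S.image f).card ≤ S.card := Finset.card_image_le
    rw [pow_succ]
    omega

/-- A growth step may add any part of what the function `f` offers. -/
theorem GrowsFrom.step (h : GrowsFrom G q D S) (hST : S ⊆ T)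
    (f : V → V) (hT : ∀ t ∈ T, t ∉ S → ∃ p ∈ S, G.Adj p t ∧ f p = t) :
    GrowsFrom G q (D + 1) T := by
  classical
  have := GrowsFrom.succ D S (fun p => if G.Adj p (f p) ∧ f p ∈ T then f p else p) h
    (by intro p _; split_ifs with h1
        · exact Or.inr h1.1
        · exact Or.inl rfl)
  convert this using 1
  ext t
  simp only [Finset.mem_union, Finset.mem_image]
  constructor
  · intro ht
    by_cases hs : t ∈ S
    · exact Or.inl hs
    · obtain ⟨p, hp, hadj, rfl⟩ := hT t ht hs
      exact Or.inr ⟨p, hp, by simp [hadj, ht]⟩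
  · rintro (ht | ⟨p, hp, rfl⟩)
    · exact hST ht
    · split_ifs with h1
      · exact h1.2
      · exact hST hp

/-- All sizes up to that of a grown set occur in the same number of steps. -/
theorem GrowsFrom.exists_card_eq (h : GrowsFrom G q D S) {m : ℕ} (hm : 1 ≤ m) (hmS : m ≤ S.card) :
    ∃ T, GrowsFrom G q D T ∧ T.card = m := by
  induction h with
  | zero => exact ⟨_, .zero, by simp at hmS ⊢; omega⟩
  | succ D S f hS hf ih =>
    by_cases hc : m ≤ S.card
    · obtain ⟨T, hT, rfl⟩ := ih hc
      exact ⟨T, hT.step subset_rfl id (fun t h1 h2 => absurd h1 h2), rfl⟩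
    · obtain ⟨T, h1, h2, h3⟩ := Finset.exists_subsuperset_card_eq
        (Finset.subset_union_left (s₁ := S) (s₂ := S.image f)) (by omega) hmS
      refine ⟨T, hS.step h1 f (fun t ht hts => ?_), h3⟩
      rcases Finset.mem_union.1 (h2 ht) with h | h
      · exact absurd h hts
      · obtain ⟨p, hp, rfl⟩ := Finset.mem_image.1 h
        rcases hf p hp with h' | h'
        · rw [h'] at hts; exact absurd hp hts
        · exact ⟨p, hp, h', rfl⟩

variable {W : Type*} [DecidableEq W]

theorem GrowsFrom.map (ι : W ↪ V) {H : SimpleGraph W}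
    (hι : ∀ u v, H.Adj u v → G.Adj (ι u) (ι v)) {w : W} {S : Finset W}
    (h : GrowsFrom H w D S) : GrowsFrom G (ι w) D (S.map ι) := by
  induction h with
  | zero => simpa using GrowsFrom.zero (G := G) (q := ι w)
  | succ D S f hS hf ih =>
    have : Nonempty W := ⟨w⟩
    refine ih.step (Finset.map_subset_map.2 Finset.subset_union_left)
      (fun v => ι (f (Function.invFun ι v))) ?_
    intro t ht hts
    obtain ⟨u, hu, rfl⟩ := Finset.mem_map.1 ht
    have hus : u ∉ S := fun h => hts (Finset.mem_map_of_mem _ h)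
    rcases Finset.mem_union.1 hu with h | h
    · exact absurd h hus
    · obtain ⟨p, hp, rfl⟩ := Finset.mem_image.1 h
      refine ⟨ι p, Finset.mem_map_of_mem _ hp, hι _ _ ?_, ?_⟩
      · rcases hf p hp with h' | h'
        · rw [h'] at hus; exact absurd hp hus
        · exact h'
      · simp [Function.leftInverse_invFun ι.injective p]

theorem GrowsFrom.of_map (ι : W ↪ V) {H : SimpleGraph W}
    (hι : ∀ u v, G.Adj (ι u) (ι v) → H.Adj u v) {w : W}
    (h : GrowsFrom G (ι w) D T) {S : Finset W} (hT : T = S.map ι) : GrowsFrom H w D S := by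
  induction h generalizing S with
  | zero =>
    obtain rfl : S = {w} := Finset.map_injective ι (by rw [← hT]; simp)
    exact .zero
  | succ D T f hTG hf ih =>
    have : Nonempty W := ⟨w⟩
    have hsub : T ⊆ S.map ι := hT ▸ Finset.subset_union_left
    obtain ⟨S₀, hS₀, rfl⟩ := Finset.subset_map_iff.1 hsub
    refine (ih rfl).step hS₀ (fun v => Function.invFun ι (f (ι v))) ?_
    intro t ht hts
    have htT : ι t ∈ S₀.map ι ∪ (S₀.map ι).image f := hT ▸ Finset.mem_map_of_mem _ ht
    have hts' : ι t ∉ S₀.map ι := by simpa using hts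
    rcases Finset.mem_union.1 htT with h | h
    · exact absurd h hts'
    · obtain ⟨p', hp', hfp⟩ := Finset.mem_image.1 h
      obtain ⟨p, hp, rfl⟩ := Finset.mem_map.1 hp'
      refine ⟨p, hp, hι _ _ ?_, ?_⟩
      · rcases hf _ hp' with h' | h'
        · rw [← hfp, h'] at hts'; exact absurd hp' hts'
        · rwa [hfp] at h'
      · simp [hfp, Function.leftInverse_invFun ι.injective t]

end Growth

theorem growsFrom_top {n : ℕ} (hn : 0 < n) (D : ℕ) :
    GrowsFrom (⊤ : SimpleGraph (Fin n)) ⟨0, hn⟩ D {i | (i : ℕ) < 2 ^ D} := by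
  induction D with
  | zero =>
    have h0 : ({i | (i : ℕ) < 2 ^ 0} : Finset (Fin n)) = {⟨0, hn⟩} := by
      ext i
      simp [Fin.ext_iff]
    rw [h0]
    exact .zero
  | succ D ih =>
    refine ih.step ?_ (fun p => if h : p.1 + 2 ^ D < n then ⟨p.1 + 2 ^ D, h⟩ else p) ?_
    · intro i
      simp only [Finset.mem_filter, Finset.mem_univ, true_and, pow_succ]
      omega
    · intro t ht hts
      simp only [Finset.mem_filter, Finset.mem_univ, true_and, pow_succ, not_lt] at ht hts
      have hpos : 0 < 2 ^ D := by positivity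
      refine ⟨⟨t.1 - 2 ^ D, by omega⟩, ?_, ?_, ?_⟩
      · simp only [Finset.mem_filter, Finset.mem_univ, true_and]; omega
      · simp only [SimpleGraph.top_adj, ne_eq, Fin.ext_iff]; omega
      · have h1 : t.1 - 2 ^ D + 2 ^ D = t.1 := by omega
        simp [h1]

/-- On the chain the growth starts in the middle; after `k + 1` steps it fills the window of
length `2 (k + 1)` around the bond to the right of the starting site. -/
theorem growsFrom_pathGraph {n D : ℕ} (hD : 1 ≤ D) (hDn : D < n) (k : ℕ) :
    GrowsFrom (SimpleGraph.pathGraph n) ⟨D - 1, by omega⟩ (k + 1)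
      {i | D ≤ (i : ℕ) + (k + 1) ∧ (i : ℕ) < D + (k + 1)} := by
  induction k with
  | zero =>
    refine GrowsFrom.zero.step ?_ (fun _ => ⟨D, hDn⟩) ?_
    · intro i
      simp only [Finset.mem_singleton, Fin.ext_iff, Finset.mem_filter, Finset.mem_univ, true_and]
      omega
    · intro t ht hts
      simp only [Finset.mem_singleton, Fin.ext_iff, Finset.mem_filter, Finset.mem_univ,
        true_and] at ht hts
      refine ⟨_, Finset.mem_singleton_self _, ?_, ?_⟩
      · simp only [SimpleGraph.pathGraph_adj]; omega
      · simp only [Fin.ext_iff]; omega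
  | succ k ih =>
    -- the left end of the window grows to the left, its right end to the right
    refine ih.step ?_ (fun p => if p.1 < D then ⟨p.1 - 1, by omega⟩ else
      if h : p.1 + 1 < n then ⟨p.1 + 1, h⟩ else p) ?_
    · intro i
      simp only [Finset.mem_filter, Finset.mem_univ, true_and]
      omega
    · intro t ht hts
      simp only [Finset.mem_filter, Finset.mem_univ, true_and] at ht hts
      by_cases htD : t.1 < D
      · refine ⟨⟨t.1 + 1, by omega⟩, ?_, ?_, ?_⟩
        · simp only [Finset.mem_filter, Finset.mem_univ, true_and]; omega
        · exact SimpleGraph.pathGraph_adj.2 (Or.inr rfl)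
        · have : t.1 + 1 < D := by omega
          simp [this]
      · refine ⟨⟨t.1 - 1, by omega⟩, ?_, ?_, ?_⟩
        · simp only [Finset.mem_filter, Finset.mem_univ, true_and]; omega
        · simp only [SimpleGraph.pathGraph_adj]; omega
        · have h1 : ¬ t.1 - 1 < D := by omega
          have h2 : t.1 - 1 + 1 = t.1 := by omega
          simp [h1, h2]

theorem GrowsFrom.pathGraph_window {n D : ℕ} {q : Fin n} {S : Finset (Fin n)}
    (h : GrowsFrom (SimpleGraph.pathGraph n) q D S) :
    ∃ a : ℤ, ∀ i ∈ S, a ≤ (i : ℕ) ∧ ((i : ℕ) : ℤ) < a + max 1 (2 * D) := by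
  induction h with
  | zero => exact ⟨q, by simp⟩
  | succ D S f hS hf ih =>
    obtain ⟨a, ha⟩ := ih
    rcases Nat.eq_zero_or_pos D with rfl | hD
    · cases hS
      have hfq := hf q (by simp)
      simp only [SimpleGraph.pathGraph_adj] at hfq
      refine ⟨min (q : ℕ) (f q : ℕ), fun i hi => ?_⟩
      simp only [Finset.image_singleton, Finset.mem_union, Finset.mem_singleton] at hi
      rcases hfq with h | h
      · rw [h] at hi ⊢
        rcases hi with rfl | rfl <;> omega
      · rcases hi with rfl | rfl <;> omega
    · refine ⟨a - 1, fun i hi => ?_⟩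
      rcases Finset.mem_union.1 hi with h | h
      · have := ha i h
        push_cast
        omega
      · obtain ⟨p, hp, rfl⟩ := Finset.mem_image.1 h
        have := ha p hp
        have hfp := hf p hp
        simp only [SimpleGraph.pathGraph_adj] at hfp
        push_cast
        rcases hfp with h' | h'
        · rw [h']; omega
        · omega

theorem GrowsFrom.pathGraph_le {n D : ℕ} (hn : 2 ≤ n) {q : Fin n}
    (h : GrowsFrom (SimpleGraph.pathGraph n) q D Finset.univ) : n ≤ 2 * D := by
  obtain ⟨a, ha⟩ := h.pathGraph_window
  have h0 := ha ⟨0, by omega⟩ (Finset.mem_univ _)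
  have h1 := ha ⟨n - 1, by omega⟩ (Finset.mem_univ _)
  simp only at h0 h1
  omega

/-! ### Growth on the square lattice -/

theorem grown_iff_growsFrom {D : ℕ} {S : Finset (ℤ × ℤ)} :
    Grown D S ↔ GrowsFrom squareLattice (0, 0) D S := by
  constructor <;> intro h
  · induction h with
    | zero => exact .zero
    | succ D S f _ hf ih => exact .succ D S f ih hf
  · induction h with
    | zero => exact .zero
    | succ D S f _ hf ih => exact .succ D S f ih hf

theorem Grown.card_le_gamma2 {D : ℕ} {S : Finset (ℤ × ℤ)} (h : Grown D S) : S.card ≤ gamma2 D :=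
  (gamma2_isGreatest D).2 ⟨S, h, rfl⟩

theorem gamma2_zero : gamma2 0 = 1 := by
  obtain ⟨S, hS, h⟩ := (gamma2_isGreatest 0).1
  cases hS
  simpa using h.symm

/-- A largest grown set can add the right neighbour of one of its rightmost points. -/
theorem gamma2_strictMono : StrictMono gamma2 := by
  refine strictMono_nat_of_lt_succ fun D => ?_
  obtain ⟨S, hS, h⟩ := (gamma2_isGreatest D).1
  have hS' := grown_iff_growsFrom.1 hS
  obtain ⟨p, hp, hmax⟩ := S.exists_max_image Prod.fst ⟨_, hS'.mem⟩
  have hnot : (p.1 + 1, p.2) ∉ S := fun hmem => by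
    have := hmax _ hmem
    simp at this
  have := hS'.step (Finset.subset_insert (p.1 + 1, p.2) S) (fun _ => (p.1 + 1, p.2)) (by
    intro t ht hts
    obtain rfl := (Finset.mem_insert.1 ht).resolve_right hts
    exact ⟨p, hp, by simp [squareLattice], rfl⟩)
  have := (grown_iff_growsFrom.2 this).card_le_gamma2
  rw [Finset.card_insert_of_notMem hnot] at this
  omega

theorem exists_le_gamma2 (n : ℕ) : ∃ d, n ≤ gamma2 d := ⟨n, gamma2_strictMono.le_apply⟩

/-- Growth in a layout is growth in the lattice, up to a translation to the origin. -/
theorem GrowsFrom.le_gamma2 {n D : ℕ} {site : Fin n ↪ ℤ × ℤ} {q : Fin n}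
    (h : GrowsFrom (layoutGraph site) q D Finset.univ) : n ≤ gamma2 D := by
  have := h.map (G := squareLattice) (site.trans (Equiv.subRight (site q)).toEmbedding)
    (by intro u v; simp [squareLattice])
  simp only [Function.Embedding.trans_apply, Equiv.coe_toEmbedding, Equiv.subRight_apply,
    sub_self] at this
  simpa using (grown_iff_growsFrom.2 this).card_le_gamma2

theorem exists_layout_growsFrom {n D : ℕ} (hn : 1 ≤ n) (hD : n ≤ gamma2 D) :
    ∃ site : Fin n ↪ ℤ × ℤ, ∃ q, GrowsFrom (layoutGraph site) q D Finset.univ := by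
  obtain ⟨S, hS, h⟩ := (gamma2_isGreatest D).1
  obtain ⟨T, hT, hcard⟩ := (grown_iff_growsFrom.1 hS).exists_card_eq hn (hD.trans h.ge)
  let e : Fin n ≃ T := (T.equivFinOfCardEq hcard).symm
  let site : Fin n ↪ ℤ × ℤ := e.toEmbedding.trans (Function.Embedding.subtype _)
  have hq : site (e.symm ⟨_, hT.mem⟩) = (0, 0) := by simp [site]
  refine ⟨site, e.symm ⟨_, hT.mem⟩, GrowsFrom.of_map (G := squareLattice) (T := T) site
    (fun u v h => h) (by rwa [hq]) ?_⟩
  ext x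
  simp only [Finset.mem_map, Finset.mem_univ, true_and]
  constructor
  · intro hx
    exact ⟨e.symm ⟨x, hx⟩, by simp [site]⟩
  · rintro ⟨i, rfl⟩
    exact (e i).2

/-! ### The GHZ state and its phase flip -/

section GHZ

variable {Q : Type*} [Fintype Q]

/-- The state `(|0…0⟩ - |1…1⟩) / √2`. -/
def ghzMinus : Ket Q := ((Real.sqrt 2 : ℂ))⁻¹ • (ketZero - ketOne)

theorem ghz_apply (x : Bits Q) :
    (ghz : Ket Q) x = ((Real.sqrt 2 : ℂ))⁻¹ *
      ((if x = fun _ => 0 then 1 else 0) + (if x = fun _ => 1 then 1 else 0)) := by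
  simp [ghz, ketZero, ketOne, Pi.single_apply]

theorem ghzMinus_apply (x : Bits Q) :
    (ghzMinus : Ket Q) x = ((Real.sqrt 2 : ℂ))⁻¹ *
      ((if x = fun _ => 0 then 1 else 0) - (if x = fun _ => 1 then 1 else 0)) := by
  simp [ghzMinus, ketZero, ketOne, Pi.single_apply]

theorem const_zero_ne_const_one {Q : Type*} [Nonempty Q] :
    (fun _ : Q => (0 : Fin 2)) ≠ fun _ => 1 :=
  fun h => Fin.zero_ne_one (congrFun h (Classical.arbitrary Q))

/-- A phase flip of any one qubit of the GHZ state gives the same state, whichever the qubit. -/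
theorem ghzMinus_apply_eq (r : Q) (x : Bits Q) :
    (ghzMinus : Ket Q) x = (-1) ^ (x r : ℕ) * (ghz : Ket Q) x := by
  have : Nonempty Q := ⟨r⟩
  rw [ghz_apply, ghzMinus_apply]
  by_cases h0 : x = fun _ => 0
  · subst h0
    simp [const_zero_ne_const_one]
  · by_cases h1 : x = fun _ => 1
    · subst h1
      simp [const_zero_ne_const_one.symm]
    · simp [h0, h1]

theorem ghz_zeros [Nonempty Q] : (ghz : Ket Q) (fun _ => 0) = ((Real.sqrt 2 : ℂ))⁻¹ := by
  simp [ghz_apply, const_zero_ne_const_one]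

theorem ghz_ones [Nonempty Q] : (ghz : Ket Q) (fun _ => 1) = ((Real.sqrt 2 : ℂ))⁻¹ := by
  simp [ghz_apply, const_zero_ne_const_one.symm]

theorem ghzMinus_zeros [Nonempty Q] :
    (ghzMinus : Ket Q) (fun _ => 0) = ((Real.sqrt 2 : ℂ))⁻¹ := by
  simp [ghzMinus_apply, const_zero_ne_const_one]

theorem ghzMinus_ones [Nonempty Q] :
    (ghzMinus : Ket Q) (fun _ => 1) = -((Real.sqrt 2 : ℂ))⁻¹ := by
  simp [ghzMinus_apply, const_zero_ne_const_one.symm]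

/-- Off the corners `|0…0⟩⟨1…1|` and `|1…1⟩⟨0…0|`, in particular between basis states that agree
on some qubit, the phase flip does not change the density matrix. -/
theorem pureState_ghzMinus_apply {r : Q} {x y : Bits Q} (h : x r = y r) :
    pureState (ghzMinus : Ket Q) x y = pureState (ghz : Ket Q) x y := by
  simp only [pureState, Matrix.vecMulVec_apply, Pi.star_apply, ghzMinus_apply_eq r, h, star_mul']
  rcases (by omega : y r = 0 ∨ y r = 1) with hy | hy <;> simp [hy]

open scoped ComplexOrder in
theorem isDensityMatrix_pureState_ghzMinus [DecidableEq Q] [Nonempty Q] :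
    IsDensityMatrix (pureState (ghzMinus : Ket Q)) where
  posSemidef := Matrix.posSemidef_vecMulVec_self_star _
  trace_eq_one := by
    have h (x : Bits Q) : pureState (ghzMinus : Ket Q) x x =
        (if x = fun _ => 0 then 2⁻¹ else 0) + (if x = fun _ => 1 then 2⁻¹ else 0) := by
      have h2 : ((Real.sqrt 2 : ℂ))⁻¹ * ((Real.sqrt 2 : ℂ))⁻¹ = 2⁻¹ := by
        rw [← mul_inv, ← Complex.ofReal_mul, Real.mul_self_sqrt (by norm_num)]
        norm_num
      by_cases h0 : x = fun _ => 0
      · subst h0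
        simp [pureState, Matrix.vecMulVec_apply, ghzMinus_zeros, const_zero_ne_const_one, h2]
      · by_cases h1 : x = fun _ => 1
        · subst h1
          simp [pureState, Matrix.vecMulVec_apply, ghzMinus_ones, const_zero_ne_const_one.symm,
            h2]
        · simp [pureState, Matrix.vecMulVec_apply, ghzMinus_apply, h0, h1]
    simp only [Matrix.trace, Matrix.diag_apply, h, Finset.sum_add_distrib, Finset.sum_ite_eq',
      Finset.mem_univ, if_true]
    norm_num

theorem not_isUDA_ghz [DecidableEq Q] [Nonempty Q] :
    ¬ IsUDA (localSubsystems Q (Fintype.card Q - 1)) (ghz : Ket Q) := by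
  intro h
  have heq := h _ isDensityMatrix_pureState_ghzMinus (by
    intro s hs
    obtain ⟨r, hr⟩ : ∃ r, r ∉ s := by
      by_contra! hall
      have hcard : s.card ≤ Fintype.card Q - 1 := hs
      rw [Finset.eq_univ_iff_forall.2 hall, Finset.card_univ] at hcard
      have := Fintype.card_pos (α := Q)
      omega
    ext a b
    refine Finset.sum_congr rfl fun c _ => pureState_ghzMinus_apply (r := r) ?_
    simp [glue, hr])
  have h01 := congrFun (congrFun heq fun _ => 0) fun _ => 1
  simp only [pureState, Matrix.vecMulVec_apply, Pi.star_apply, ghz_zeros, ghz_ones,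
    ghzMinus_zeros, ghzMinus_ones, star_neg, mul_neg, neg_eq_self] at h01
  simp at h01

end GHZ

/-! ### Local operators and their spreading under layers -/

section Register

variable {Q : Type*} [DecidableEq Q]

/-- The matrix unit `|a⟩⟨b|` on the qubit `q`, as an operator on the register. -/
def matrixUnit (q : Q) (a b : Fin 2) : Module.End ℂ (Ket Q) where
  toFun ψ x := if x q = a then ψ (Function.update x q b) else 0
  map_add' ψ φ := by ext x; simp only [Pi.add_apply]; split_ifs <;> simp
  map_smul' c ψ := by ext x; simp

theorem matrixUnit_apply (q : Q) (a b : Fin 2) (ψ : Ket Q) (x : Bits Q) :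
    matrixUnit q a b ψ x = if x q = a then ψ (Function.update x q b) else 0 := rfl

theorem matrixUnit_commute {q r : Q} (h : q ≠ r) (a b c d : Fin 2) :
    Commute (matrixUnit q a b) (matrixUnit r c d) := by
  ext ψ x
  simp only [Module.End.mul_apply, matrixUnit_apply, Function.update_of_ne h,
    Function.update_of_ne h.symm, Function.update_comm h]
  split_ifs <;> rfl

/-- The algebra of operators on the register that act only on the qubits of `S`. -/
def localAlg (S : Set Q) : Subalgebra ℂ (Module.End ℂ (Ket Q)) :=
  Algebra.adjoin ℂ {T | ∃ q ∈ S, ∃ a b, T = matrixUnit q a b}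

theorem localAlg_mono {S T : Set Q} (h : S ⊆ T) : localAlg S ≤ localAlg T :=
  Algebra.adjoin_mono fun _ ⟨q, hq, hA⟩ => ⟨q, h hq, hA⟩

theorem matrixUnit_mem_localAlg {S : Set Q} {q : Q} (hq : q ∈ S) (a b : Fin 2) :
    matrixUnit q a b ∈ localAlg S :=
  Algebra.subset_adjoin ⟨q, hq, a, b, rfl⟩

theorem localAlg_commute {S T : Set Q} (h : Disjoint S T) {A B : Module.End ℂ (Ket Q)}
    (hA : A ∈ localAlg S) (hB : B ∈ localAlg T) : Commute A B := by
  refine Algebra.commute_of_mem_adjoin_of_forall_mem_commute hB ?_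
  rintro _ ⟨r, hr, c, d, rfl⟩
  refine (Algebra.commute_of_mem_adjoin_of_forall_mem_commute hA ?_).symm
  rintro _ ⟨q, hq, a, b, rfl⟩
  exact matrixUnit_commute (h.ne_of_mem hq hr).symm c d a b

/-- The operator on the register that acts as the matrix `M` on the pair of qubits `a`, `b`. -/
def pairOp (a b : Q) (M : Matrix (Fin 2 × Fin 2) (Fin 2 × Fin 2) ℂ) : Module.End ℂ (Ket Q) :=
  ∑ i, ∑ j, M i j • (matrixUnit a i.1 j.1 * matrixUnit b i.2 j.2)

theorem pairOp_mem_localAlg (a b : Q) (M : Matrix (Fin 2 × Fin 2) (Fin 2 × Fin 2) ℂ) :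
    pairOp a b M ∈ localAlg {a, b} :=
  sum_mem fun _ _ => sum_mem fun _ _ => Subalgebra.smul_mem _
    (mul_mem (matrixUnit_mem_localAlg (by simp) _ _) (matrixUnit_mem_localAlg (by simp) _ _)) _

theorem pairOp_apply {a b : Q} (h : a ≠ b) (M : Matrix (Fin 2 × Fin 2) (Fin 2 × Fin 2) ℂ)
    (ψ : Ket Q) (x : Bits Q) :
    pairOp a b M ψ x =
      ∑ j, M (x a, x b) j * ψ (Function.update (Function.update x a j.1) b j.2) := by
  have key (i j : Fin 2 × Fin 2) :
      (M i j • (matrixUnit a i.1 j.1 * matrixUnit b i.2 j.2)) ψ x =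
        if (x a, x b) = i then
          M i j * ψ (Function.update (Function.update x a j.1) b j.2) else 0 := by
    simp only [LinearMap.smul_apply, Pi.smul_apply, Module.End.mul_apply, matrixUnit_apply,
      Function.update_of_ne h.symm, smul_eq_mul, Prod.ext_iff]
    by_cases h1 : x a = i.1 <;> by_cases h2 : x b = i.2 <;> simp [h1, h2]
  simp only [pairOp, LinearMap.sum_apply, Finset.sum_apply, key]
  rw [Finset.sum_comm]
  simp

theorem pairOp_one {a b : Q} (h : a ≠ b) : pairOp a b 1 = 1 := by
  ext1 ψ
  ext x
  simp [pairOp_apply h, Matrix.one_apply]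

theorem pairOp_mul {a b : Q} (h : a ≠ b) (M N : Matrix (Fin 2 × Fin 2) (Fin 2 × Fin 2) ℂ) :
    pairOp a b M * pairOp a b N = pairOp a b (M * N) := by
  ext1 ψ
  ext x
  have h1 (p p' : Fin 2 × Fin 2) : Function.update (Function.update
      (Function.update (Function.update x a p.1) b p.2) a p'.1) b p'.2 =
      Function.update (Function.update x a p'.1) b p'.2 := by
    rw [Function.update_comm h.symm, Function.update_idem, Function.update_idem]
  simp only [Module.End.mul_apply, pairOp_apply h, Function.update_of_ne h, Function.update_self,
    h1, Matrix.mul_apply, Finset.sum_mul, Finset.mul_sum]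
  rw [Finset.sum_comm]
  simp only [mul_assoc]

/-- The Pauli operator `Z` on the qubit `r`. -/
def pauliZ (r : Q) : Module.End ℂ (Ket Q) := matrixUnit r 0 0 - matrixUnit r 1 1

theorem pauliZ_mem_localAlg (r : Q) : pauliZ r ∈ localAlg ({r} : Set Q) :=
  sub_mem (matrixUnit_mem_localAlg (Set.mem_singleton r) _ _)
    (matrixUnit_mem_localAlg (Set.mem_singleton r) _ _)

theorem pauliZ_apply (r : Q) (ψ : Ket Q) (x : Bits Q) :
    pauliZ r ψ x = (-1) ^ (x r : ℕ) * ψ x := by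
  have h (a : Fin 2) : matrixUnit r a a ψ x = if x r = a then ψ x else 0 := by
    rw [matrixUnit_apply]
    split_ifs with hx
    · rw [← hx, Function.update_eq_self]
    · rfl
  rw [pauliZ, LinearMap.sub_apply, Pi.sub_apply, h, h]
  rcases (by omega : x r = 0 ∨ x r = 1) with hx | hx <;> simp [hx]

variable [Fintype Q] {G : SimpleGraph Q}

theorem Gate.mulVec_toOp (g : Gate G) (ψ : Ket Q) :
    g.toOp.mulVec ψ = pairOp g.fst g.snd g.mat ψ := by
  have hne := g.adj.ne
  ext x
  rw [pairOp_apply hne]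
  symm
  refine Finset.sum_of_injOn
    (fun j : Fin 2 × Fin 2 => Function.update (Function.update x g.fst j.1) g.snd j.2)
    ?_ (fun _ _ => Finset.mem_univ _) ?_ ?_
  · intro i _ j _ hij
    have h1 := congrFun hij g.fst
    have h2 := congrFun hij g.snd
    simp only [Function.update_of_ne hne, Function.update_self] at h1 h2
    exact Prod.ext h1 h2
  · intro y _ hy
    suffices h : g.toOp x y = 0 from mul_eq_zero_of_left h _
    refine if_neg fun hxy => ?_
    refine hy ⟨(y g.fst, y g.snd), Finset.mem_coe.2 (Finset.mem_univ _), ?_⟩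
    ext q : 1
    by_cases h2 : q = g.snd
    · subst h2; simp
    · by_cases h1 : q = g.fst
      · subst h1; simp [hne]
      · simp [h1, h2, hxy q h1 h2]
  · intro j _
    dsimp only
    congr 1
    refine Eq.trans ?_ (if_pos fun q h1 h2 => by simp [h1, h2]).symm
    simp [hne]

/-- Conjugation with a layer enlarges the support of an operator at most by the partners, in the
layer, of the qubits of the support. -/
theorem exists_spread_of_gates (gs : List (Gate G))
    (hgs : gs.Pairwise (fun g h => Disjoint g.support h.support)) :
    ∃ U U' : Module.End ℂ (Ket Q), ∃ f : Q → Q,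
      (∀ ψ, U ψ = (gs.map Gate.toOp).prod.mulVec ψ) ∧ U * U' = 1 ∧ U' * U = 1 ∧
      (∀ p, f p = p ∨ ∃ g ∈ gs, (p = g.fst ∧ f p = g.snd) ∨ (p = g.snd ∧ f p = g.fst)) ∧
      ∀ (S : Finset Q), ∀ A ∈ localAlg (S : Set Q),
        U * A * U' ∈ localAlg (↑(S ∪ S.image f) : Set Q) := by
  induction gs with
  | nil =>
    refine ⟨1, 1, id, by simp, by simp, by simp, by simp, ?_⟩
    intro S A hA
    simpa using hA
  | cons g gs ih =>
    rw [List.pairwise_cons] at hgs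
    obtain ⟨U, U', f, hU, hUU', hU'U, hf, hspread⟩ := ih hgs.2
    have hne := g.adj.ne
    have hmm : (g.mat : Matrix (Fin 2 × Fin 2) (Fin 2 × Fin 2) ℂ) * star g.mat.1 = 1 :=
      Unitary.mul_star_self_of_mem g.mat.2
    have hmm' : star g.mat.1 * (g.mat : Matrix (Fin 2 × Fin 2) (Fin 2 × Fin 2) ℂ) = 1 :=
      Unitary.star_mul_self_of_mem g.mat.2
    set T := pairOp g.fst g.snd g.mat with hT
    set T' := pairOp g.fst g.snd (star g.mat.1) with hT'
    have hTT' : T * T' = 1 := by rw [hT, hT', pairOp_mul hne, hmm, pairOp_one hne]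
    have hT'T : T' * T = 1 := by rw [hT, hT', pairOp_mul hne, hmm', pairOp_one hne]
    -- the gates of `gs` do not touch the qubits of `g`
    have hfix : ∀ p ∈ g.support, ∀ q, f q = p → q = p := by
      intro p hp q hq
      rcases hf q with h | ⟨h, hh, ⟨h1, h2⟩ | ⟨h1, h2⟩⟩
      · rw [← hq, h]
      · exact absurd (show p ∈ h.support by simp [Gate.support, ← hq, h2])
          (Finset.disjoint_left.1 (hgs.1 h hh) hp)
      · exact absurd (show p ∈ h.support by simp [Gate.support, ← hq, h2])
          (Finset.disjoint_left.1 (hgs.1 h hh) hp)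
    have hfix' : ∀ p ∈ g.support, f p = p := by
      intro p hp
      rcases hf p with h | ⟨h, hh, ⟨h1, h2⟩ | ⟨h1, h2⟩⟩
      · exact h
      · exact absurd (show p ∈ h.support by simp [Gate.support, ← h1])
          (Finset.disjoint_left.1 (hgs.1 h hh) hp)
      · exact absurd (show p ∈ h.support by simp [Gate.support, ← h1])
          (Finset.disjoint_left.1 (hgs.1 h hh) hp)
    have hsupp (p : Q) : p ∈ g.support ↔ p = g.fst ∨ p = g.snd := by simp [Gate.support]
    let f' : Q → Q := fun p => if p = g.fst then g.snd else if p = g.snd then g.fst else f p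
    have hf'1 : f' g.fst = g.snd := by simp [f']
    have hf'2 : f' g.snd = g.fst := by simp [f', hne.symm]
    have hf'3 : ∀ p ∉ g.support, f' p = f p := by
      intro p hp
      rw [hsupp, not_or] at hp
      simp [f', hp.1, hp.2]
    refine ⟨T * U, U' * T', f', ?_, ?_, ?_, ?_, ?_⟩
    · intro ψ
      rw [Module.End.mul_apply, hU, List.map_cons, List.prod_cons, ← Matrix.mulVec_mulVec,
        Gate.mulVec_toOp]
    · rw [mul_assoc, ← mul_assoc U, hUU', one_mul, hTT']
    · rw [mul_assoc, ← mul_assoc T', hT'T, one_mul, hU'U]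
    · intro p
      by_cases hp : p ∈ g.support
      · refine Or.inr ⟨g, by simp, ?_⟩
        rcases (hsupp p).1 hp with rfl | rfl
        · exact Or.inl ⟨rfl, hf'1⟩
        · exact Or.inr ⟨rfl, hf'2⟩
      · rw [hf'3 p hp]
        rcases hf p with h | ⟨h, hh, h'⟩
        · exact Or.inl h
        · exact Or.inr ⟨h, List.mem_cons_of_mem _ hh, h'⟩
    · intro S A hA
      have hUA := hspread S A hA
      have heq : T * U * A * (U' * T') = T * (U * A * U') * T' := by simp only [mul_assoc]
      have hsub : S ∪ S.image f ⊆ S ∪ S.image f' := by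
        refine Finset.union_subset Finset.subset_union_left ?_
        intro y hy
        obtain ⟨p, hp, rfl⟩ := Finset.mem_image.1 hy
        by_cases hpg : p ∈ g.support
        · rw [hfix' p hpg]
          exact Finset.mem_union_left _ hp
        · rw [← hf'3 p hpg]
          exact Finset.mem_union_right _ (Finset.mem_image_of_mem _ hp)
      rw [heq]
      by_cases hd : Disjoint ({g.fst, g.snd} : Set Q) (↑(S ∪ S.image f) : Set Q)
      · rw [(localAlg_commute hd (pairOp_mem_localAlg _ _ _) hUA).eq, mul_assoc, hTT', mul_one]
        exact localAlg_mono (Finset.coe_subset.2 hsub) hUA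
      · obtain ⟨p, hpg, hp⟩ := Set.not_disjoint_iff.1 hd
        have hpS : p ∈ S := by
          rcases Finset.mem_union.1 (Finset.mem_coe.1 hp) with h | h
          · exact h
          · obtain ⟨q, hq, hqp⟩ := Finset.mem_image.1 h
            rwa [← hfix p ((hsupp p).2 (by simpa using hpg)) q hqp]
        have hg : ({g.fst, g.snd} : Set Q) ⊆ ↑(S ∪ S.image f') := by
          have h1 := Finset.mem_union_left (S.image f') hpS
          have h2 := Finset.mem_union_right S (Finset.mem_image_of_mem f' hpS)
          rcases (show p = g.fst ∨ p = g.snd by simpa using hpg) with rfl | rfl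
          · rw [hf'1] at h2
            exact Set.insert_subset h1 (Set.singleton_subset_iff.2 h2)
          · rw [hf'2] at h2
            exact Set.insert_subset h2 (Set.singleton_subset_iff.2 h1)
        exact mul_mem (mul_mem (localAlg_mono hg (pairOp_mem_localAlg _ _ _))
          (localAlg_mono (Finset.coe_subset.2 hsub) hUA)) (localAlg_mono hg
            (pairOp_mem_localAlg _ _ _))

/-- The forward light cone of a qubit `q` under a circuit `C`: conjugation with `C` turns the
operators on `q` into operators on a set that grows from `q` in as many steps as `C` has layers. -/
theorem exists_lightCone (C : Circuit G) :
    ∃ U U' : Module.End ℂ (Ket Q), U ketZero = output C ∧ U * U' = 1 ∧ U' * U = 1 ∧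
      ∀ q, ∃ S, GrowsFrom G q C.length S ∧
        ∀ A ∈ localAlg ({q} : Set Q), U * A * U' ∈ localAlg (S : Set Q) := by
  induction C using List.reverseRecOn with
  | nil =>
    refine ⟨1, 1, rfl, by simp, by simp, fun q => ⟨{q}, .zero, ?_⟩⟩
    intro A hA
    simpa using hA
  | append_singleton C L ih =>
    obtain ⟨U, U', hU, hUU', hU'U, hcone⟩ := ih
    obtain ⟨T, T', f, hT, hTT', hT'T, hf, hspread⟩ :=
      exists_spread_of_gates L.gates L.pairwise_disjoint
    refine ⟨T * U, U' * T', ?_, ?_, ?_, ?_⟩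
    · rw [Module.End.mul_apply, hU, hT, output, output, List.foldl_append]
      rfl
    · rw [mul_assoc, ← mul_assoc U, hUU', one_mul, hTT']
    · rw [mul_assoc, ← mul_assoc T', hT'T, one_mul, hU'U]
    · intro q
      obtain ⟨S, hS, hA⟩ := hcone q
      refine ⟨S ∪ S.image f, ?_, ?_⟩
      · rw [List.length_append, List.length_singleton]
        refine .succ _ _ f hS fun p _ => ?_
        rcases hf p with h | ⟨g, _, ⟨rfl, h⟩ | ⟨rfl, h⟩⟩
        · exact Or.inl h
        · exact Or.inr (h ▸ g.adj)
        · exact Or.inr (h ▸ g.adj.symm)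
      · intro A hAq
        have := hspread S _ (hA A hAq)
        rwa [show T * U * A * (U' * T') = T * (U * A * U') * T' by simp only [mul_assoc]]

/-! ### The light cone of a circuit that prepares the GHZ state -/

theorem pauliZ_ghz (r : Q) : pauliZ r ghz = (ghzMinus : Ket Q) := by
  ext x
  rw [pauliZ_apply, ghzMinus_apply_eq r]

/-- If no forward light cone filled the register, `ghzMinus`, which differs from `ghz` by a
phase flip outside any given light cone, would be prepared by the circuit as well. -/
theorem exists_growsFrom_univ [Nonempty Q] {C : Circuit G} (hC : output C = ghz) :
    ∃ q, GrowsFrom G q C.length Finset.univ := by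
  obtain ⟨U, U', hU, hUU', hU'U, hcone⟩ := exists_lightCone C
  by_contra! hno
  have hzero : U' ghz = ketZero := by
    rw [← hC, ← hU, ← Module.End.mul_apply, hU'U, Module.End.one_apply]
  have hkill : ∀ q, matrixUnit q 1 1 (U' ghzMinus) = 0 := by
    intro q
    obtain ⟨S, hS, hA⟩ := hcone q
    obtain ⟨r, hr⟩ : ∃ r, r ∉ S := by
      by_contra! hall
      exact hno q (Finset.eq_univ_iff_forall.2 hall ▸ hS)
    have hcomm : Commute (U * matrixUnit q 1 1 * U') (pauliZ r) :=
      localAlg_commute (T := {r}) (by simpa using hr)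
        (hA _ (matrixUnit_mem_localAlg (Set.mem_singleton q) _ _)) (pauliZ_mem_localAlg r)
    have hq0 : matrixUnit q 1 1 (ketZero : Ket Q) = 0 := by
      ext x
      have hx : Function.update x q 1 ≠ fun _ => 0 := fun h => by
        simpa using congrFun h q
      simp [matrixUnit_apply, ketZero, hx]
    have h1 : (U * matrixUnit q 1 1 * U') ghzMinus = 0 := by
      rw [← pauliZ_ghz r, ← Module.End.mul_apply, hcomm.eq, Module.End.mul_apply,
        Module.End.mul_apply, Module.End.mul_apply, hzero, hq0, map_zero, map_zero]
    calc matrixUnit q 1 1 (U' ghzMinus)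
        = (U' * U) (matrixUnit q 1 1 (U' ghzMinus)) := by rw [hU'U, Module.End.one_apply]
      _ = U' ((U * matrixUnit q 1 1 * U') ghzMinus) := rfl
      _ = 0 := by rw [h1, map_zero]
  obtain ⟨c, hc⟩ : ∃ c : ℂ, U' ghzMinus = c • ketZero := by
    refine ⟨U' ghzMinus (fun _ => 0), ?_⟩
    ext x
    by_cases hx : x = fun _ => 0
    · simp [hx, ketZero]
    · obtain ⟨q, hq⟩ := Function.ne_iff.1 hx
      have hq1 : x q = 1 := by omega
      have := congrFun (hkill q) x
      rw [matrixUnit_apply, if_pos hq1, ← hq1, Function.update_eq_self] at this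
      simp [this, ketZero, hx]
  have hm : (ghzMinus : Ket Q) = c • ghz := by
    rw [← hC, ← hU, ← map_smul, ← hc, ← Module.End.mul_apply, hUU', Module.End.one_apply]
  have hs : ((Real.sqrt 2 : ℂ))⁻¹ ≠ 0 := by simp
  have h0 := congrFun hm fun _ => 0
  have h1 := congrFun hm fun _ => 1
  rw [Pi.smul_apply, smul_eq_mul, ghz_zeros, ghzMinus_zeros] at h0
  rw [Pi.smul_apply, smul_eq_mul, ghz_ones, ghzMinus_ones, ← h0, neg_eq_self] at h1
  exact hs h1

end Register

/-! ### CNOT circuits along a growth -/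

theorem cnot_mem_unitaryGroup : cnot ∈ Matrix.unitaryGroup (Fin 2 × Fin 2) ℂ := by
  rw [Matrix.mem_unitaryGroup_iff]
  ext ⟨a, b⟩ ⟨c, d⟩
  fin_cases a <;> fin_cases b <;> fin_cases c <;> fin_cases d <;>
    simp [Matrix.mul_apply, Fintype.sum_prod_type, cnot, Matrix.star_apply]

/-- A Hadamard gate on the first qubit followed by a CNOT onto the second one. -/
def bellMatrix : Matrix (Fin 2 × Fin 2) (Fin 2 × Fin 2) ℂ :=
  fun x y => if x.2 = x.1 + y.2 then (-1) ^ ((x.1 : ℕ) * (y.1 : ℕ)) * ((Real.sqrt 2 : ℂ))⁻¹ else 0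

theorem bellMatrix_mem_unitaryGroup : bellMatrix ∈ Matrix.unitaryGroup (Fin 2 × Fin 2) ℂ := by
  have h2 : ((Real.sqrt 2 : ℂ))⁻¹ * ((Real.sqrt 2 : ℂ))⁻¹ = 2⁻¹ := by
    rw [← mul_inv, ← Complex.ofReal_mul, Real.mul_self_sqrt (by norm_num)]
    norm_num
  rw [Matrix.mem_unitaryGroup_iff]
  ext ⟨a, b⟩ ⟨c, d⟩
  fin_cases a <;> fin_cases b <;> fin_cases c <;> fin_cases d <;>
    simp [Matrix.mul_apply, Fintype.sum_prod_type, bellMatrix, Matrix.star_apply, h2] <;>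
    norm_num

section Register

variable {Q : Type*} [DecidableEq Q] {G : SimpleGraph Q}

theorem IsCnotGrowth.exists_pad {C : Circuit G} {S : Finset Q} (h : IsCnotGrowth C S) (k : ℕ) :
    ∃ C' : Circuit G, C'.length = C.length + k ∧ IsCnotGrowth C' S := by
  induction k with
  | zero => exact ⟨C, rfl, h⟩
  | succ k ih =>
    obtain ⟨C', hlen, hC'⟩ := ih
    refine ⟨C' ++ [⟨[], List.Pairwise.nil⟩], by simp [hlen]; rfl, ?_⟩
    simpa using hC'.step _ _ ⟨[], List.Pairwise.nil⟩ (by simp)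

/-- The growth of `S` by a set `T` of neighbours, each of them offered by a vertex of `S`, is
carried out by one layer of CNOTs; since `f` is a function, the controls are distinct. -/
theorem exists_cnotLayer (S : Finset Q) (f : Q → Q) (T : Finset Q) (hST : Disjoint S T)
    (hT : ∀ t ∈ T, ∃ p ∈ S, G.Adj p t ∧ f p = t) :
    ∃ L : Layer G, (∀ g ∈ L.gates, (g.mat : Matrix (Fin 2 × Fin 2) (Fin 2 × Fin 2) ℂ) = cnot ∧
      g.fst ∈ S ∧ f g.fst = g.snd) ∧ (L.gates.map Gate.snd).toFinset = T := by
  induction T using Finset.induction_on with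
  | empty => exact ⟨⟨[], List.Pairwise.nil⟩, by simp, by simp⟩
  | insert t T htT ih =>
    rw [Finset.disjoint_insert_right] at hST
    obtain ⟨L, hL, hLT⟩ := ih hST.2 fun u hu => hT u (Finset.mem_insert_of_mem hu)
    obtain ⟨p, hp, hadj, hfp⟩ := hT t (Finset.mem_insert_self _ _)
    refine ⟨⟨⟨p, t, hadj, ⟨cnot, cnot_mem_unitaryGroup⟩⟩ :: L.gates,
      List.pairwise_cons.2 ⟨fun g hg => ?_, L.pairwise_disjoint⟩⟩, ?_, ?_⟩
    · obtain ⟨-, h1, h2⟩ := hL g hg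
      have h3 : g.snd ∈ T := by
        rw [← hLT, List.mem_toFinset]
        exact List.mem_map_of_mem hg
      have h4 : g.snd ∉ S := Finset.disjoint_right.1 hST.2 h3
      simp only [Gate.support, Finset.disjoint_insert_left, Finset.disjoint_singleton_left,
        Finset.mem_insert, Finset.mem_singleton, not_or]
      refine ⟨⟨?_, ?_⟩, ?_, ?_⟩
      · rintro rfl; rw [← hfp, h2] at htT; exact htT h3
      · rintro rfl; exact h4 hp
      · rintro rfl; exact hST.1 h1
      · rintro rfl; exact htT h3
    · intro g hg
      rcases List.mem_cons.1 hg with rfl | hg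
      · exact ⟨rfl, hp, hfp⟩
      · exact hL g hg
    · simp [hLT]

/-- Idle steps of the growth before the second qubit is reached are made up for by idle layers
after the preparation of the Bell pair. -/
theorem GrowsFrom.exists_isCnotGrowth {q : Q} {D : ℕ} {S : Finset Q} (h : GrowsFrom G q D S)
    (hS : 2 ≤ S.card) : ∃ C : Circuit G, C.length = D ∧ IsCnotGrowth C S := by
  induction h with
  | zero => simp at hS
  | succ D S f hG hf ih =>
    by_cases hc : 2 ≤ S.card
    · obtain ⟨C, hlen, hC⟩ := ih hc
      obtain ⟨L, hL, hLT⟩ := exists_cnotLayer (G := G) S f (S.image f \ S)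
        Finset.disjoint_sdiff (by
          intro t ht
          obtain ⟨ht1, ht2⟩ := Finset.mem_sdiff.1 ht
          obtain ⟨p, hp, rfl⟩ := Finset.mem_image.1 ht1
          refine ⟨p, hp, (hf p hp).resolve_left fun h => ?_, rfl⟩
          rw [h] at ht2
          exact ht2 hp)
      refine ⟨C ++ [L], by simp [hlen], ?_⟩
      have := hC.step C S L fun g hg => ⟨(hL g hg).1, (hL g hg).2.1, fun hmem => by
        have h3 : g.snd ∈ (L.gates.map Gate.snd).toFinset :=
          List.mem_toFinset.2 (List.mem_map_of_mem hg)
        rw [hLT] at h3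
        exact (Finset.mem_sdiff.1 h3).2 hmem⟩
      rwa [hLT, Finset.union_sdiff_self_eq_union] at this
    · obtain rfl : S = {q} := by
        refine (Finset.eq_of_subset_of_card_le (Finset.singleton_subset_iff.2 hG.mem) ?_).symm
        simp
        omega
      have hne : f q ≠ q := fun h => by simp [h] at hS
      let g : Gate G := ⟨q, f q, (hf q (by simp)).resolve_left hne,
        ⟨bellMatrix, bellMatrix_mem_unitaryGroup⟩⟩
      have hg : g.MakesBell := by
        intro a b
        simp [g, bellMatrix, eq_comm]
      obtain ⟨C, hlen, hC⟩ :=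
        (IsCnotGrowth.bell ⟨[g], List.pairwise_singleton _ _⟩ g rfl hg).exists_pad D
      refine ⟨C, by rw [hlen, List.length_singleton, add_comm], ?_⟩
      simpa [g, Gate.support] using hC

/-! ### The output of a CNOT growth -/

/-- The basis label that is `1` exactly on `S`. -/
def indicator (S : Finset Q) : Bits Q := fun q => if q ∈ S then 1 else 0

variable [Fintype Q]

theorem Gate.mulVec_single_of_cnot {g : Gate G}
    (hg : (g.mat : Matrix (Fin 2 × Fin 2) (Fin 2 × Fin 2) ℂ) = cnot) (y : Bits Q) :
    g.toOp.mulVec (Pi.single y 1) =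
      Pi.single (Function.update y g.snd (y g.fst + y g.snd)) 1 := by
  have hne := g.adj.ne
  rw [Matrix.mulVec_single_one]
  ext x
  rw [Matrix.col_apply, Pi.single_apply, Gate.toOp, hg]
  by_cases hx : x = Function.update y g.snd (y g.fst + y g.snd)
  · rw [if_pos hx, if_pos]
    · simp [hx, cnot, hne]
    · intro q _ h2
      simp [hx, h2]
  · rw [if_neg hx]
    split_ifs with h
    · rw [cnot, if_neg]
      rintro h'
      obtain ⟨h1, h2⟩ := Prod.ext_iff.1 h'
      refine hx (funext fun q => ?_)
      by_cases hq2 : q = g.snd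
      · subst hq2; simpa using h2
      · rw [Function.update_of_ne hq2]
        by_cases hq1 : q = g.fst
        · subst hq1; exact h1
        · exact h q hq1 hq2
    · rfl

/-- The CNOTs of a layer, controlled from `S`, flip their targets if all bits of `S` are `1`. -/
theorem cnotGates_mulVec_indicator (gs : List (Gate G))
    (hgs : gs.Pairwise (fun g h => Disjoint g.support h.support)) (S : Finset Q)
    (h : ∀ g ∈ gs, (g.mat : Matrix (Fin 2 × Fin 2) (Fin 2 × Fin 2) ℂ) = cnot ∧
      g.fst ∈ S ∧ g.snd ∉ S) :
    (gs.map Gate.toOp).prod.mulVec (Pi.single (indicator S) 1) =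
      Pi.single (indicator (S ∪ (gs.map Gate.snd).toFinset)) 1 := by
  induction gs with
  | nil => rw [List.map_nil, List.prod_nil, Matrix.one_mulVec, List.map_nil, List.toFinset_nil,
      Finset.union_empty]
  | cons g gs ih =>
    rw [List.pairwise_cons] at hgs
    obtain ⟨hc, h1, h2⟩ := h g (by simp)
    have h3 : g.snd ∉ (gs.map Gate.snd).toFinset := by
      simp only [List.mem_toFinset, List.mem_map, not_exists, not_and]
      intro k hk heq
      exact Finset.disjoint_left.1 (hgs.1 k hk) (show g.snd ∈ g.support by simp [Gate.support])
        (by simp [Gate.support, heq])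
    rw [List.map_cons, List.prod_cons, ← Matrix.mulVec_mulVec,
      ih hgs.2 fun k hk => h k (List.mem_cons_of_mem _ hk), Gate.mulVec_single_of_cnot hc]
    congr 1
    ext q : 1
    by_cases hq : q = g.snd
    · subst hq
      simp [indicator, h1, h2, h3]
    · simp [indicator, hq]

theorem cnotGates_mulVec_ketZero (gs : List (Gate G))
    (h : ∀ g ∈ gs, (g.mat : Matrix (Fin 2 × Fin 2) (Fin 2 × Fin 2) ℂ) = cnot) :
    (gs.map Gate.toOp).prod.mulVec ketZero = ketZero := by
  induction gs with
  | nil => simp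
  | cons g gs ih =>
    rw [List.map_cons, List.prod_cons, ← Matrix.mulVec_mulVec,
      ih fun k hk => h k (List.mem_cons_of_mem _ hk), ketZero,
      Gate.mulVec_single_of_cnot (h g (by simp))]
    congr 1
    ext q : 1
    by_cases hq : q = g.snd
    · subst hq; simp
    · simp [hq]

/-- A CNOT growth prepares the GHZ state of the qubits that it has reached. -/
theorem IsCnotGrowth.output_eq {C : Circuit G} {S : Finset Q} (h : IsCnotGrowth C S) :
    output C = ((Real.sqrt 2 : ℂ))⁻¹ • (ketZero + Pi.single (indicator S) 1) := by
  induction h with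
  | bell L g hL hg =>
    have hne := g.adj.ne
    have h1 : output [L] = g.toOp.mulVec ketZero := by
      simp [output, Layer.toOp, hL]
    rw [h1, ketZero, Matrix.mulVec_single_one]
    ext x
    rw [Matrix.col_apply, Gate.toOp, hg]
    have hind : indicator g.support ≠ fun _ => 0 := fun h => by
      have := congrFun h g.fst
      simp [indicator, Gate.support] at this
    by_cases h0 : x = fun _ => 0
    · subst h0
      simp [hind.symm]
    · by_cases h1 : x = indicator g.support
      · subst h1
        rw [if_pos]
        · rw [Pi.smul_apply, Pi.add_apply, Pi.single_eq_of_ne h0, Pi.single_eq_same]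
          simp [indicator, Gate.support]
        · intro q hq1 hq2
          simp [indicator, Gate.support, hq1, hq2]
      · have : (if ∀ q, q ≠ g.fst → q ≠ g.snd → x q = 0 then
            if x g.fst = x g.snd then ((Real.sqrt 2 : ℂ))⁻¹ else 0 else 0) = 0 := by
          refine ite_eq_right_iff.2 fun hx => if_neg fun heq => ?_
          rcases (by omega : x g.fst = 0 ∨ x g.fst = 1) with hf | hf
          · refine h0 (funext fun q => ?_)
            by_cases hq1 : q = g.fst
            · rw [hq1, hf]
            · by_cases hq2 : q = g.snd
              · rw [hq2, ← heq, hf]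
              · exact hx q hq1 hq2
          · refine h1 (funext fun q => ?_)
            by_cases hq1 : q = g.fst
            · simp [hq1, hf, indicator, Gate.support]
            · by_cases hq2 : q = g.snd
              · simp [hq2, ← heq, hf, indicator, Gate.support]
              · simp [indicator, Gate.support, hq1, hq2, hx q hq1 hq2]
        rw [this]
        simp [h0, h1]
  | step C S L _ hL ih =>
    have h1 : output (C ++ [L]) = L.toOp.mulVec (output C) := by
      simp [output, List.foldl_append]
    rw [h1, ih, Matrix.mulVec_smul, Matrix.mulVec_add, Layer.toOp,
      cnotGates_mulVec_ketZero _ fun g hg => (hL g hg).1,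
      cnotGates_mulVec_indicator _ L.pairwise_disjoint S hL]

theorem IsCnotGrowth.output_eq_ghz {C : Circuit G} (h : IsCnotGrowth C Finset.univ) :
    output C = ghz := by
  rw [h.output_eq, ghz, ketOne]
  congr 3
  ext q
  simp [indicator]

/-! ### The complexity of the GHZ state on a graph -/

theorem ghzByCnotGrowth_of_growsFrom (hQ : 2 ≤ Fintype.card Q) {q : Q} {D : ℕ}
    (h : GrowsFrom G q D Finset.univ) : GhzByCnotGrowth G D := by
  obtain ⟨C, hlen, hC⟩ := h.exists_isCnotGrowth hQ
  exact ⟨C, hlen, hC, hC.output_eq_ghz⟩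

theorem GhzByCnotGrowth.circuitComplexity_le {D : ℕ} (h : GhzByCnotGrowth G D) :
    circuitComplexity G ghz ≤ D := by
  obtain ⟨C, rfl, -, hC⟩ := h
  exact iInf_le_of_le ⟨C, hC⟩ le_rfl

theorem le_circuitComplexity_ghz [Nonempty Q] {D : ℕ}
    (h : ∀ q d, GrowsFrom G q d Finset.univ → D ≤ d) : (D : ℕ∞) ≤ circuitComplexity G ghz := by
  refine le_iInf fun C => ?_
  obtain ⟨q, hq⟩ := exists_growsFrom_univ C.2
  exact Nat.cast_le.2 (h q _ hq)

theorem circuitComplexity_ghz_eq (hQ : 2 ≤ Fintype.card Q) {q : Q} {D : ℕ}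
    (hq : GrowsFrom G q D Finset.univ) (h : ∀ q d, GrowsFrom G q d Finset.univ → D ≤ d) :
    circuitComplexity G ghz = D ∧ GhzByCnotGrowth G D := by
  have : Nonempty Q := ⟨q⟩
  have hD := ghzByCnotGrowth_of_growsFrom hQ hq
  exact ⟨le_antisymm hD.circuitComplexity_le (le_circuitComplexity_ghz h), hD⟩

end Register

/-! ### The values for the three connectivities -/

theorem circuitComplexity_ghz_top {n : ℕ} (hn : 2 ≤ n) :
    circuitComplexity (⊤ : SimpleGraph (Fin n)) ghz = (⌈Real.logb 2 n⌉₊ : ℕ∞) ∧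
      GhzByCnotGrowth (⊤ : SimpleGraph (Fin n)) ⌈Real.logb 2 n⌉₊ := by
  have hlog : ⌈Real.logb 2 n⌉₊ = Nat.clog 2 n := mod_cast Real.natCeil_logb_natCast 2 n
  rw [hlog]
  have hgrow := growsFrom_top (by omega : 0 < n) (Nat.clog 2 n)
  rw [Finset.filter_true_of_mem fun i _ => i.2.trans_le (Nat.le_pow_clog (by norm_num) n)] at hgrow
  refine circuitComplexity_ghz_eq (by simpa using hn) hgrow fun q d h => ?_
  exact Nat.clog_le_of_le_pow (by simpa using h.card_le)

theorem circuitComplexity_ghz_pathGraph {n : ℕ} (hn : 2 ≤ n) :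
    circuitComplexity (SimpleGraph.pathGraph n) ghz = (⌈(n : ℝ) / 2⌉₊ : ℕ∞) ∧
      GhzByCnotGrowth (SimpleGraph.pathGraph n) ⌈(n : ℝ) / 2⌉₊ := by
  have hceil : ⌈(n : ℝ) / 2⌉₊ = (n + 1) / 2 := by
    refine (Nat.ceil_eq_iff (by omega)).2 ⟨?_, ?_⟩
    · rw [lt_div_iff₀ (by norm_num)]
      exact_mod_cast (by omega : ((n + 1) / 2 - 1) * 2 < n)
    · rw [div_le_iff₀ (by norm_num)]
      exact_mod_cast (by omega : n ≤ (n + 1) / 2 * 2)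
  rw [hceil]
  have hgrow := growsFrom_pathGraph (n := n) (D := (n + 1) / 2) (by omega) (by omega)
    ((n + 1) / 2 - 1)
  rw [Finset.filter_true_of_mem fun i _ => by omega,
    Nat.sub_add_cancel (by omega : 1 ≤ (n + 1) / 2)] at hgrow
  refine circuitComplexity_ghz_eq (by simpa using hn) hgrow fun q d h => ?_
  have := h.pathGraph_le hn
  omega

theorem squareLatticeComplexity_ghz {n D : ℕ} (hn : 2 ≤ n)
    (hD : IsLeast {d : ℕ | n ≤ gamma2 d} D) :
    squareLatticeComplexity (ghz : Ket (Fin n)) = (D : ℕ∞) ∧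
      ∃ site : Fin n ↪ ℤ × ℤ, GhzByCnotGrowth (layoutGraph site) D := by
  have : Nonempty (Fin n) := ⟨⟨0, by omega⟩⟩
  obtain ⟨site, q, hq⟩ := exists_layout_growsFrom (by omega) hD.1
  have hsite := ghzByCnotGrowth_of_growsFrom (by simpa using hn) hq
  refine ⟨le_antisymm (iInf_le_of_le site hsite.circuitComplexity_le) ?_, site, hsite⟩
  exact le_iInf fun s => le_circuitComplexity_ghz fun q d h => hD.2 h.le_gamma2

/-! ### The square lattice depth in terms of extensions of `gamma2` -/

/-- If `D` is the least depth with `n ≤ γ₂ D`, an extension of `γ₂` takes the value `n` in the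
interval `(D - 1, D]`. -/
theorem isGreatest_ceil_extension {n D : ℕ} (hn : 2 ≤ n)
    (hD : IsLeast {d : ℕ | n ≤ gamma2 d} D) {g : ℝ → ℝ} (hc : ContinuousOn g (Set.Ici 0))
    (hm : StrictMonoOn g (Set.Ici 0)) (hg : ∀ d : ℕ, g d = gamma2 d) :
    IsGreatest ((fun x : ℝ => ⌈x⌉₊) '' {x : ℝ | 0 ≤ x ∧ g x ≤ n}) D := by
  have hnD : (n : ℝ) ≤ g D := by rw [hg]; exact_mod_cast hD.1
  constructor
  · obtain ⟨E, rfl⟩ : ∃ E, D = E + 1 := by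
      refine Nat.exists_eq_succ_of_ne_zero ?_
      rintro rfl
      have : n ≤ gamma2 0 := hD.1
      rw [gamma2_zero] at this
      omega
    have hE : g E < n := by
      rw [hg]
      by_contra! h
      have : E + 1 ≤ E := hD.2 (show n ≤ gamma2 E by exact_mod_cast h)
      omega
    have hE0 : (0 : ℝ) ≤ E := Nat.cast_nonneg E
    have hEE : (E : ℝ) ≤ (E + 1 : ℕ) := by push_cast; linarith
    obtain ⟨x, hx, hgx⟩ := intermediate_value_Icc hEE
      (hc.mono fun y hy => hE0.trans hy.1) ⟨hE.le, hnD⟩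
    refine ⟨x, ⟨hE0.trans hx.1, hgx.le⟩, (Nat.ceil_eq_iff (by omega)).2 ⟨?_, hx.2⟩⟩
    rw [Nat.add_sub_cancel]
    refine lt_of_le_of_ne hx.1 ?_
    rintro rfl
    exact hE.ne hgx
  · rintro _ ⟨x, ⟨hx0, hx⟩, rfl⟩
    exact Nat.ceil_le.2 ((hm.le_iff_le hx0 (Set.mem_Ici.2 (Nat.cast_nonneg D))).1 (hx.trans hnD))

theorem exists_isGreatest_gamma2_le {n D : ℕ} (hn : 2 ≤ n)
    (hD : IsLeast {d : ℕ | n ≤ gamma2 d} D) :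
    ∃ E : ℕ, IsGreatest {d : ℕ | gamma2 d ≤ n} E ∧ D = if gamma2 E = n then E else E + 1 := by
  have hnD : n ≤ gamma2 D := hD.1
  by_cases h : gamma2 D = n
  · refine ⟨D, ⟨h.le, fun d hd => ?_⟩, by rw [if_pos h]⟩
    exact gamma2_strictMono.le_iff_le.1 (le_of_le_of_eq hd h.symm)
  · obtain ⟨E, rfl⟩ : ∃ E, D = E + 1 := by
      refine Nat.exists_eq_succ_of_ne_zero ?_
      rintro rfl
      rw [gamma2_zero] at hnD
      omega
    have hE : gamma2 E < n := by
      by_contra! h'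
      have : E + 1 ≤ E := hD.2 h'
      omega
    refine ⟨E, ⟨hE.le, fun d hd => ?_⟩, by rw [if_neg hE.ne]⟩
    have hd' : gamma2 d < gamma2 (E + 1) :=
      lt_of_le_of_lt hd (lt_of_le_of_ne hnD (Ne.symm h))
    exact Nat.lt_succ_iff.1 (gamma2_strictMono.lt_iff_lt.1 hd')

end QCircuit

end

theorem mainTheorem3 (n : ℕ) (hn : 2 ≤ n) :
    -- the GHZ state is not determined by its marginals on at most `n - 1` qubits
    ¬ QCircuit.IsUDA (QCircuit.localSubsystems (Fin n) (n - 1)) QCircuit.ghz ∧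
    -- all-to-all connectivity
    (QCircuit.circuitComplexity (⊤ : SimpleGraph (Fin n)) QCircuit.ghz
        = (⌈Real.logb 2 n⌉₊ : ℕ∞) ∧
      QCircuit.GhzByCnotGrowth (⊤ : SimpleGraph (Fin n)) ⌈Real.logb 2 n⌉₊) ∧
    -- one-dimensional chain
    (QCircuit.circuitComplexity (SimpleGraph.pathGraph n) QCircuit.ghz
        = (⌈(n : ℝ) / 2⌉₊ : ℕ∞) ∧
      QCircuit.GhzByCnotGrowth (SimpleGraph.pathGraph n) ⌈(n : ℝ) / 2⌉₊) ∧
    -- square lattice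
    (∃ D : ℕ,
      QCircuit.squareLatticeComplexity (QCircuit.ghz : QCircuit.Ket (Fin n)) = (D : ℕ∞) ∧
      (∃ site : Fin n ↪ ℤ × ℤ, QCircuit.GhzByCnotGrowth (QCircuit.layoutGraph site) D) ∧
      -- `D` is the least depth whose maximal light cone has at least `n` points
      IsLeast {d : ℕ | n ≤ QCircuit.gamma2 d} D ∧
      -- `D` is the maximum of `⌈x⌉` over the real `x ≥ 0` with `γ₂ x ≤ n`, for every
      -- continuous strictly increasing extension `g` of `γ₂` to real arguments
      (∀ g : ℝ → ℝ, ContinuousOn g (Set.Ici 0) → StrictMonoOn g (Set.Ici 0) →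
        (∀ d : ℕ, g d = QCircuit.gamma2 d) →
        IsGreatest ((fun x : ℝ => ⌈x⌉₊) '' {x : ℝ | 0 ≤ x ∧ g x ≤ n}) D) ∧
      -- the same in terms of the greatest integer `E` with `γ₂ E ≤ n`
      (∃ E : ℕ, IsGreatest {d : ℕ | QCircuit.gamma2 d ≤ n} E ∧
        D = if QCircuit.gamma2 E = n then E else E + 1)) := by
  have hD : IsLeast {d : ℕ | n ≤ QCircuit.gamma2 d} (Nat.find (QCircuit.exists_le_gamma2 n)) :=
    ⟨Nat.find_spec (QCircuit.exists_le_gamma2 n), fun _ hd => Nat.find_min' _ hd⟩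
  obtain ⟨hcomp, hsite⟩ := QCircuit.squareLatticeComplexity_ghz hn hD
  have : Nonempty (Fin n) := ⟨⟨0, by omega⟩⟩
  refine ⟨?_, QCircuit.circuitComplexity_ghz_top hn, QCircuit.circuitComplexity_ghz_pathGraph hn,
    _, hcomp, hsite, hD, fun g hc hm hg => QCircuit.isGreatest_ceil_extension hn hD hc hm hg,
    QCircuit.exists_isGreatest_gamma2_le hn hD⟩
  simpa using QCircuit.not_isUDA_ghz (Q := Fin n)
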